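/- Let $\Sigma_n=\{-1,1\}^n$ with Hamming distance $d_H$, and for $p\in\mathbb N$ let $\boldsymbol J=(J_{i_1,\dots,i_p})_{1\le i_1,\dots,i_p\le n}$ have i.i.d. standard normal entries. The Ising pure $p$-spin Hamiltonian is $$H(\boldsymbol\sigma)=n^{-\frac{p+1}{2}}\sum_{1\le i_1,\dots,i_p\le n}J_{i_1,\dots,i_p}\boldsymbol\sigma_{i_1}\cdots\boldsymbol\sigma_{i_p},\qquad \boldsymbol\sigma\in\Sigma_n,$$ and the Gibbs measure at inverse temperature $\beta$ is $\mu_\beta(A)=Z_\beta^{-1}\sum_{\boldsymbol\sigma\in A}e^{\beta nH(\boldsymbol\sigma)}$ with $Z_\beta=\sum_{\boldsymbol\sigma\in\Sigma_n}e^{\beta nH(\boldsymbol\sigma)}$. For nonempty $A,B\subseteq\Sigma_n$ put ${\rm diam}(A)=\max_{x,y\in A}d_H(x,y)$ and ${\rm dist}(A,B)=\min_{x\in A,y\in B}d_H(x,y)$. A $(\nu_1,\nu_2)$-clustering of $A\subseteq\Sigma_n$ is a partition $(\mathcal C_\ell)_{\ell=1}^L$ of $A$ into nonempty sets such that $d_H(\boldsymbol\sigma,\boldsymbol\sigma')\le\nu_1n$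 whenever $\boldsymbol\sigma,\boldsymbol\sigma'$ lie in the same $\mathcal C_i$, and $d_H(\boldsymbol\sigma,\boldsymbol\sigma')\ge\nu_2n$ whenever they lie in different $\mathcal C_i,\mathcal C_j$. **Theorem.** For any $\sqrt{\ln 2}<\beta<\sqrt{2\ln 2}$ there is a $\kappa_0>0$ such that for every $0<\kappa<\kappa_0$ there exist $P^*\in\mathbb N$, $0<\nu_1<\frac12\nu_2<\nu_2<1$ and $c,c'>0$ such that the following holds. For any $p\ge P^*$, the Gibbs measure is $(2\nu_1,\nu_2)$-shattered at inverse temperature $\beta$, with constants $c,c'$, and the clusters are a $(\nu_1,\nu_2)$-clustering of the energy band. That is, there is a deterministic sequence $\delta_n\to0$ such that with probability tending to $1$ as $n\to\infty$ (with $p$ fixed) there is a $(\nu_1,\nu_2)$-clustering $(\mathcal C_\ell)_{\ell=1}^L$ of $$\{\boldsymbol\sigma\in\Sigma_n:|H(\boldsymbol\sigma)-\beta|\le\kappa\sqrt{2\ln 2}\}$$ with the following properties: (a) $\frac1n\log_2L\ge c$; (b) $\max_{1\le i\le L}{\rm diam}(\mathcal C_i)\le 2\nu_1n$ and $\min_{1\le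 i<j\le L}{\rm dist}(\mathcal C_i,\mathcal C_j)\ge\nu_2n$; (c) $\max_{1\le i\le L}\mu_\beta(\mathcal C_i)\le e^{-c'n}$; (d) $\mu_\beta\bigl(\bigcup_{1\le i\le L}\mathcal C_i\bigr)\ge1-\delta_n$. -/

import Mathlib

namespace IsingPSpin

/-- The discrete cube `{-1, 1}^n`; the unit group `ℤˣ` is the two-point set `{-1, 1}`. -/
abbrev Config (n : ℕ) : Type := Fin n → ℤˣ

/-- Order-`p` tensors on `ℝ^n`: one real entry `J (i₁, …, i_p)` per multi-index. -/
abbrev Tensor (n p : ℕ) : Type := (Fin p → Fin n) → ℝ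

/-- The law of the disorder: the entries of the tensor are i.i.d. standard normal. -/
noncomputable def disorder (n p : ℕ) : MeasureTheory.Measure (Tensor n p) :=
  MeasureTheory.Measure.pi fun _ => ProbabilityTheory.gaussianReal 0 1

/-- The pure `p`-spin Hamiltonian
`H(σ) = n^{-(p+1)/2} ∑_{i₁,…,i_p} J_{i₁,…,i_p} σ_{i₁} ⋯ σ_{i_p}`. -/
noncomputable def hamiltonian {n p : ℕ} (J : Tensor n p) (σ : Config n) : ℝ :=
  (n : ℝ) ^ (-((p : ℝ) + 1) / 2) * ∑ I : Fin p → Fin n, J I * ∏ k : Fin p, ((σ (I k) : ℤ) : ℝ)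

/-- The partition function `Z_β = ∑_σ exp(β n H(σ))`. -/
noncomputable def partitionFunction {n p : ℕ} (β : ℝ) (J : Tensor n p) : ℝ :=
  ∑ σ : Config n, Real.exp (β * n * hamiltonian J σ)

/-- The Gibbs mass `μ_β(A) = Z_β⁻¹ ∑_{σ ∈ A} exp(β n H(σ))`. -/
noncomputable def gibbs {n p : ℕ} (β : ℝ) (J : Tensor n p) (A : Finset (Config n)) : ℝ :=
  (∑ σ ∈ A, Real.exp (β * n * hamiltonian J σ)) / partitionFunction β J

/-- The energy band `{σ : |H(σ) - β| ≤ κ √(2 ln 2)}`. -/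
noncomputable def energyBand {n p : ℕ} (β κ : ℝ) (J : Tensor n p) : Finset (Config n) :=
  Finset.univ.filter fun σ => |hamiltonian J σ - β| ≤ κ * √(2 * Real.log 2)

/-- The Hamming diameter of a set of configurations. -/
def diam {n : ℕ} (A : Finset (Config n)) : ℕ :=
  (A ×ˢ A).sup fun x => hammingDist x.1 x.2

/-- The Hamming distance between two (nonempty) sets of configurations: the minimum of the
pairwise Hamming distances. -/
noncomputable def setDist {n : ℕ} (A B : Finset (Config n)) : ℕ :=
  sInf {d : ℕ | ∃ x ∈ A, ∃ y ∈ B, hammingDist x y = d}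

/-- `C₁, …, C_L` is a `(ν₁, ν₂)`-clustering of `A`: a partition of `A` into nonempty parts, such
that points of one part are at Hamming distance at most `ν₁ n` and points of different parts are
at Hamming distance at least `ν₂ n`. -/
structure IsClustering {n L : ℕ} (ν₁ ν₂ : ℝ) (A : Finset (Config n))
    (C : Fin L → Finset (Config n)) : Prop where
  nonempty : ∀ i, (C i).Nonempty
  disjoint : ∀ i j, i ≠ j → Disjoint (C i) (C j)
  union : Finset.univ.biUnion C = A
  within : ∀ i, ∀ σ ∈ C i, ∀ σ' ∈ C i, (hammingDist σ σ' : ℝ) ≤ ν₁ * n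
  between : ∀ i j, i ≠ j → ∀ σ ∈ C i, ∀ σ' ∈ C j, ν₂ * n ≤ (hammingDist σ σ' : ℝ)

/-- For a given disorder `J`, the clusters `C₁, …, C_L` witness `(a, b)`-shattering of the Gibbs
measure at inverse temperature `β` with constants `c, c'`, up to a remaining Gibbs mass `δ`. -/
structure IsShatteredBy {n p L : ℕ} (β a b c c' δ : ℝ) (J : Tensor n p)
    (C : Fin L → Finset (Config n)) : Prop where
  nonempty : ∀ i, (C i).Nonempty
  exponentially_many : c ≤ 1 / (n : ℝ) * Real.logb 2 L
  confined : ∀ i, (diam (C i) : ℝ) ≤ a * n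
  separated : ∀ i j, i < j → b * n ≤ (setDist (C i) (C j) : ℝ)
  subdominant : ∀ i, gibbs β J (C i) ≤ Real.exp (-c' * n)
  collective : 1 - δ ≤ gibbs β J (Finset.univ.biUnion C)

end IsingPSpin

namespace IsingPSpin

open MeasureTheory ProbabilityTheory Filter Topology

/-! ### Gaussian exponential moments -/

/-! The energies `n H(σ)` form a centred Gaussian field with covariance `n R ^ p`, where `R` is the
overlap, so for large `p` only nearly equal or nearly antipodal configurations interact. Put `η = κ
√(2 log 2)`. Three bad events have vanishing probability.

Overlap gap: both energies of a nearly uncorrelated pair exceed `n (β - η)` with probability about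
`exp (-n (β - η) ^ 2)`. There are `2 ^ n exp (ε n)` pairs at distance between `ν₁ n` and `ν₂ n`, and
`β > √(log 2)` makes the union bound win (`measureReal_exists_pair_le`). Closeness is then an
equivalence relation on the band (`exists_isClustering`).

Partition function: `Z_β` is at least half its mean (`measureReal_partitionFunction_lt_le`). The
plain second moment fails for `β ^ 2 > log 2`, because nearly equal pairs dominate it; discarding
energies above `n (β + η)` repairs it throughout `β ^ 2 < 2 log 2`.

Energy band: tilting by `±η` and Markov's inequality bound the weight outside it
(`measureReal_outside_le`).

Outside these events, a cluster lies in a small Hamming ball and has energies at most `n (β + η)`,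
so its mass is exponentially small. As the clusters carry at least half of the mass, there are
exponentially many (`isShatteredBy_of_isClustering`). -/

theorem integrable_exp_linear {ι : Type*} [Fintype ι] (a : ι → ℝ) :
    Integrable (fun J : ι → ℝ => Real.exp (∑ i, a i * J i))
      (Measure.pi fun _ => gaussianReal 0 1) := by
  simp_rw [Real.exp_sum]
  exact Integrable.fintype_prod (f := fun i x => Real.exp (a i * x))
    fun i => integrable_exp_mul_gaussianReal (a i)

theorem integral_exp_linear {ι : Type*} [Fintype ι] (a : ι → ℝ) :
    ∫ J : ι → ℝ, Real.exp (∑ i, a i * J i) ∂(Measure.pi fun _ => gaussianReal 0 1)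
      = Real.exp ((∑ i, a i * a i) / 2) := by
  simp_rw [Real.exp_sum]
  rw [integral_fintype_prod_eq_prod (f := fun i x => Real.exp (a i * x)), Finset.sum_div,
    Real.exp_sum]
  refine Finset.prod_congr rfl fun i _ => ?_
  have h := congrFun (mgf_id_gaussianReal (μ := 0) (v := 1)) (a i)
  simp only [mgf, id] at h
  rw [h]
  congr 1
  simp
  ring

instance (n p : ℕ) : IsProbabilityMeasure (disorder n p) := by
  unfold disorder; infer_instance

/-! ### Overlaps and the covariance of the energies -/

/-- The unnormalised inner product `∑ i, σ i * τ i`. -/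
noncomputable def innerSum {n : ℕ} (σ τ : Config n) : ℝ := ∑ i, ((σ i : ℤ) : ℝ) * ((τ i : ℤ) : ℝ)

/-- The overlap `⟨σ, τ⟩ / n`. -/
noncomputable def overlap {n : ℕ} (σ τ : Config n) : ℝ := innerSum σ τ / n

/-- The extensive energy `n H(σ)`. -/
noncomputable def energy {n p : ℕ} (J : Tensor n p) (σ : Config n) : ℝ := n * hamiltonian J σ

/-- The coefficients of `energy` as a linear form in the disorder. -/
noncomputable def coeff {n : ℕ} (p : ℕ) (σ : Config n) (I : Fin p → Fin n) : ℝ :=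
  n * (n : ℝ) ^ (-((p : ℝ) + 1) / 2) * ∏ k : Fin p, ((σ (I k) : ℤ) : ℝ)

theorem energy_eq_sum {n p : ℕ} (J : Tensor n p) (σ : Config n) :
    energy J σ = ∑ I, coeff p σ I * J I := by
  simp only [energy, hamiltonian, coeff, Finset.mul_sum]
  exact Finset.sum_congr rfl fun I _ => by ring

/-- This is the covariance of the energies: expanding `innerSum σ τ ^ p` over multi-indices gives
the sum, and the normalisation contributes `n ^ 2 * n ^ (-(p + 1))`. -/
theorem sum_coeff_mul_coeff {n : ℕ} (hn : 0 < n) (p : ℕ) (σ τ : Config n) :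
    ∑ I, coeff p σ I * coeff p τ I = n * overlap σ τ ^ p := by
  have hn' : (0 : ℝ) < n := by exact_mod_cast hn
  have h1 : ((n : ℝ) * (n : ℝ) ^ (-((p : ℝ) + 1) / 2)) * (n * (n : ℝ) ^ (-((p : ℝ) + 1) / 2))
      = n * ((n : ℝ) ^ p)⁻¹ := by
    have : (n : ℝ) ^ (-((p : ℝ) + 1) / 2) * (n : ℝ) ^ (-((p : ℝ) + 1) / 2)
        = ((n : ℝ) ^ p)⁻¹ * (n : ℝ)⁻¹ := by
      rw [← Real.rpow_add hn', ← Real.rpow_natCast, ← Real.rpow_neg hn'.le,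
        ← Real.rpow_neg_one, ← Real.rpow_add hn']
      congr 1
      ring
    calc _ = (n : ℝ) * n * ((n : ℝ) ^ (-((p : ℝ) + 1) / 2) * (n : ℝ) ^ (-((p : ℝ) + 1) / 2)) := by
          ring
      _ = _ := by rw [this]; field_simp
  have h2 : innerSum σ τ ^ p
      = ∑ I : Fin p → Fin n, ∏ k, ((σ (I k) : ℤ) : ℝ) * ((τ (I k) : ℤ) : ℝ) := by
    rw [innerSum, Finset.sum_pow', Fintype.piFinset_univ]
  calc ∑ I, coeff p σ I * coeff p τ I
      = ∑ I : Fin p → Fin n, ((n : ℝ) * (n : ℝ) ^ (-((p : ℝ) + 1) / 2))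
          * (n * (n : ℝ) ^ (-((p : ℝ) + 1) / 2))
          * ∏ k, ((σ (I k) : ℤ) : ℝ) * ((τ (I k) : ℤ) : ℝ) := by
        refine Finset.sum_congr rfl fun I _ => ?_
        rw [coeff, coeff, Finset.prod_mul_distrib]
        ring
    _ = _ := by
        rw [← Finset.mul_sum, ← h2, h1, overlap, div_pow]
        field_simp

theorem sq_unit (u : ℤˣ) : ((u : ℤ) : ℝ) * ((u : ℤ) : ℝ) = 1 := by
  rcases Int.units_eq_one_or u with h | h <;> simp [h]

theorem innerSum_self {n : ℕ} (σ : Config n) : innerSum σ σ = n := by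
  simp [innerSum, sq_unit]

theorem innerSum_eq_sub {n : ℕ} (σ τ : Config n) :
    innerSum σ τ = n - 2 * hammingDist σ τ := by
  have : ∀ i, ((σ i : ℤ) : ℝ) * ((τ i : ℤ) : ℝ) = 1 - 2 * (if σ i ≠ τ i then 1 else 0) := by
    intro i
    rcases Int.units_eq_one_or (σ i) with h | h <;>
      rcases Int.units_eq_one_or (τ i) with h' | h' <;> simp [h, h'] <;> norm_num
  simp only [innerSum, this, Finset.sum_sub_distrib, ← Finset.mul_sum, hammingDist,
    Finset.sum_boole]
  simp

theorem abs_overlap_le_one {n : ℕ} (σ τ : Config n) : |overlap σ τ| ≤ 1 := by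
  have h := hammingDist_le_card_fintype (x := σ) (y := τ)
  have h' : (hammingDist σ τ : ℝ) ≤ n := by simpa using (Nat.cast_le (α := ℝ)).2 h
  have h0 : (0 : ℝ) ≤ hammingDist σ τ := Nat.cast_nonneg _
  rw [overlap, innerSum_eq_sub, abs_div, Nat.abs_cast]
  refine div_le_one_of_le₀ (abs_le.2 ⟨by linarith, by linarith⟩) (Nat.cast_nonneg _)

theorem integrable_exp_energy {n p : ℕ} (t : ℝ) (σ : Config n) :
    Integrable (fun J : Tensor n p => Real.exp (t * energy J σ)) (disorder n p) := by
  have := integrable_exp_linear fun I => t * coeff p σ I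
  simpa only [energy_eq_sum, Finset.mul_sum, mul_assoc, disorder] using this

theorem integral_exp_energy {n p : ℕ} (hn : 0 < n) (t : ℝ) (σ : Config n) :
    ∫ J : Tensor n p, Real.exp (t * energy J σ) ∂disorder n p = Real.exp (n * t ^ 2 / 2) := by
  have := integral_exp_linear fun I => t * coeff p σ I
  simp only [energy_eq_sum, Finset.mul_sum, disorder, ← mul_assoc] at this ⊢
  rw [this]
  have h := sum_coeff_mul_coeff hn p σ σ
  have h1 : overlap σ σ = 1 := by
    rw [overlap, innerSum_self]
    exact div_self (by exact_mod_cast hn.ne')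
  rw [h1, one_pow, mul_one] at h
  rw [← h, Finset.sum_mul]
  congr 2
  exact Finset.sum_congr rfl fun _ _ => by ring

theorem integrable_exp_energy_add {n p : ℕ} (t : ℝ) (σ τ : Config n) :
    Integrable (fun J : Tensor n p => Real.exp (t * (energy J σ + energy J τ)))
      (disorder n p) := by
  have := integrable_exp_linear fun I => t * (coeff p σ I + coeff p τ I)
  simpa only [energy_eq_sum, ← Finset.sum_add_distrib, ← add_mul, Finset.mul_sum, mul_assoc,
    disorder] using this

theorem integral_exp_energy_add {n p : ℕ} (hn : 0 < n) (t : ℝ) (σ τ : Config n) :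
    ∫ J : Tensor n p, Real.exp (t * (energy J σ + energy J τ)) ∂disorder n p
      = Real.exp (n * t ^ 2 * (1 + overlap σ τ ^ p)) := by
  have := integral_exp_linear fun I => t * (coeff p σ I + coeff p τ I)
  simp only [energy_eq_sum, ← Finset.sum_add_distrib, ← add_mul, Finset.mul_sum, disorder,
    ← mul_assoc] at this ⊢
  rw [this]
  have hself : ∀ ρ : Config n, overlap ρ ρ = 1 := fun ρ => by
    rw [overlap, innerSum_self]
    exact div_self (by exact_mod_cast hn.ne')
  have h1 := sum_coeff_mul_coeff hn p σ σ
  have h2 := sum_coeff_mul_coeff hn p τ τ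
  have h3 := sum_coeff_mul_coeff hn p σ τ
  rw [hself, one_pow, mul_one] at h1 h2
  congr 1
  have h4 : ∑ I, t * (coeff p σ I + coeff p τ I) * t * (coeff p σ I + coeff p τ I)
      = t ^ 2 * (∑ I, coeff p σ I * coeff p σ I + ∑ I, coeff p τ I * coeff p τ I
        + 2 * ∑ I, coeff p σ I * coeff p τ I) := by
    simp only [Finset.mul_sum, ← Finset.sum_add_distrib]
    exact Finset.sum_congr rfl fun _ _ => by ring
  rw [h4, h1, h2, h3]
  ring

theorem measurable_energy {n p : ℕ} (σ : Config n) :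
    Measurable fun J : Tensor n p => energy J σ := by
  simp only [energy_eq_sum]
  fun_prop

/-! ### Counting configurations by overlap -/

theorem sum_exp_innerSum {n : ℕ} (l : ℝ) (σ : Config n) :
    ∑ τ : Config n, Real.exp (l * innerSum σ τ) = (Real.exp l + Real.exp (-l)) ^ n := by
  have h : ∀ τ : Config n, Real.exp (l * innerSum σ τ)
      = ∏ i, Real.exp (l * (((σ i : ℤ) : ℝ) * ((τ i : ℤ) : ℝ))) := fun τ => by
    rw [innerSum, Finset.mul_sum, Real.exp_sum]
  simp only [h]
  rw [← Fintype.piFinset_univ, ← Finset.prod_univ_sum (fun _ => (Finset.univ : Finset ℤˣ))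
    (fun i u => Real.exp (l * (((σ i : ℤ) : ℝ) * ((u : ℤ) : ℝ))))]
  rw [Finset.prod_congr rfl (g := fun _ => Real.exp l + Real.exp (-l))]
  · simp
  · intro i _
    have hu : (Finset.univ : Finset ℤˣ) = {1, -1} := by decide
    rw [hu, Finset.sum_pair (by decide)]
    rcases Int.units_eq_one_or (σ i) with h | h <;> simp [h, add_comm]

/-- Chernoff bound for the counting measure. -/
theorem card_le_of_le_innerSum {n : ℕ} (l s : ℝ) (σ : Config n) (A : Finset (Config n))
    (hA : ∀ τ ∈ A, s ≤ l * innerSum σ τ) :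
    (A.card : ℝ) ≤ Real.exp (-s) * (Real.exp l + Real.exp (-l)) ^ n := by
  have h : (A.card : ℝ) * Real.exp s ≤ (Real.exp l + Real.exp (-l)) ^ n := by
    rw [← sum_exp_innerSum l σ]
    calc (A.card : ℝ) * Real.exp s = ∑ τ ∈ A, Real.exp s := by simp
      _ ≤ ∑ τ ∈ A, Real.exp (l * innerSum σ τ) :=
          Finset.sum_le_sum fun τ hτ => Real.exp_le_exp.2 (hA τ hτ)
      _ ≤ _ := Finset.sum_le_sum_of_subset_of_nonneg (Finset.subset_univ _)
          fun _ _ _ => (Real.exp_pos _).le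
  rw [Real.exp_neg, ← div_eq_inv_mul, le_div_iff₀ (Real.exp_pos _)]
  exact h

theorem card_innerSum_eq_le {n : ℕ} (hn : 0 < n) (s : ℝ) (σ : Config n) (A : Finset (Config n))
    (hA : ∀ τ ∈ A, innerSum σ τ = s) :
    (A.card : ℝ) ≤ 2 ^ n * Real.exp (-(s ^ 2 / n) / 2) := by
  have hn' : (n : ℝ) ≠ 0 := by exact_mod_cast hn.ne'
  -- The tilt `s / n` is optimal once `cosh l` is replaced by `exp (l ^ 2 / 2)`.
  have h := card_le_of_le_innerSum (s / n) (s ^ 2 / n) σ A fun τ hτ => by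
    rw [hA τ hτ]; apply le_of_eq; ring
  refine h.trans ?_
  have hc : Real.exp (s / n) + Real.exp (-(s / n)) ≤ 2 * Real.exp ((s / n) ^ 2 / 2) := by
    have := Real.cosh_le_exp_half_sq (s / n)
    rw [Real.cosh_eq] at this
    linarith
  calc _ ≤ Real.exp (-(s ^ 2 / n)) * (2 * Real.exp ((s / n) ^ 2 / 2)) ^ n := by
        gcongr
    _ = 2 ^ n * (Real.exp (-(s ^ 2 / n)) * Real.exp (n * ((s / n) ^ 2 / 2))) := by
        rw [mul_pow, ← Real.exp_nat_mul]; ring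
    _ = _ := by
        rw [← Real.exp_add]
        congr 2
        field_simp
        ring

/-- Hamming balls of small radius, together with their antipodes, are exponentially small. -/
theorem exists_card_innerSum_le (ε : ℝ) (hε : 0 < ε) :
    ∃ ν : ℝ, 0 < ν ∧ ∀ (n : ℕ) (σ : Config n) (A : Finset (Config n)) (u : ℝ), (u = 1 ∨ u = -1) →
      (∀ τ ∈ A, (1 - 2 * ν) * n ≤ u * innerSum σ τ) → (A.card : ℝ) ≤ Real.exp (ε * n) := by
  obtain ⟨l, hl0, hl⟩ : ∃ l : ℝ, 0 < l ∧ Real.exp (-(2 * l)) ≤ ε / 2 := by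
    have h : Tendsto (fun l : ℝ => Real.exp (-(2 * l))) atTop (𝓝 0) :=
      Real.tendsto_exp_neg_atTop_nhds_zero.comp (tendsto_id.const_mul_atTop (by norm_num))
    obtain ⟨l, h1, h2⟩ := ((eventually_gt_atTop 0).and
      (h.eventually_lt_const (half_pos hε))).exists
    exact ⟨l, h1, h2.le⟩
  -- With this radius the loss `2 ν l` equals `ε / 2`; the other `ε / 2` pays for `exp (-l)` in `exp
  -- l + exp (-l)`.
  refine ⟨ε / (4 * l), by positivity, fun n σ A u hu hA => ?_⟩
  have h := card_le_of_le_innerSum (u * l) (l * ((1 - 2 * (ε / (4 * l))) * n)) σ A fun τ hτ => by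
    have := mul_le_mul_of_nonneg_left (hA τ hτ) hl0.le
    linarith
  have hu' : Real.exp (u * l) + Real.exp (-(u * l)) = Real.exp l + Real.exp (-l) := by
    rcases hu with rfl | rfl
    · simp
    · simp [add_comm]
  rw [hu'] at h
  have hb : Real.exp l + Real.exp (-l) ≤ Real.exp (l + ε / 2) := by
    calc Real.exp l + Real.exp (-l) = Real.exp l * (Real.exp (-(2 * l)) + 1) := by
          rw [mul_add, ← Real.exp_add]; ring_nf
      _ ≤ Real.exp l * Real.exp (ε / 2) := by
          have := Real.add_one_le_exp (ε / 2)
          gcongr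
          linarith
      _ = _ := (Real.exp_add _ _).symm
  calc _ ≤ _ := h
    _ ≤ Real.exp (-(l * ((1 - 2 * (ε / (4 * l))) * n))) * Real.exp (l + ε / 2) ^ n := by gcongr
    _ = _ := by
      rw [← Real.exp_nat_mul, ← Real.exp_add]
      congr 1
      field_simp
      ring

/-! ### Pairs of configurations of high energy -/

/-- Chernoff bound with parameter `E`, the optimal choice for uncorrelated energies. -/
theorem measureReal_energy_add_ge_le {n p : ℕ} (hn : 0 < n) {E : ℝ} (hE : 0 ≤ E)
    (σ τ : Config n) :
    (disorder n p).real {J | 2 * n * E ≤ energy J σ + energy J τ}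
      ≤ Real.exp (n * (E ^ 2 * overlap σ τ ^ p - E ^ 2)) := by
  have h := measure_ge_le_exp_mul_mgf (μ := disorder n p)
    (X := fun J => energy J σ + energy J τ) (2 * n * E) hE (integrable_exp_energy_add E σ τ)
  refine h.trans (le_of_eq ?_)
  rw [mgf, integral_exp_energy_add hn, ← Real.exp_add]
  congr 1
  ring

/-- Union bound: the choice of `σ` costs `log 2` in the exponent, that of `τ` only `ε`. -/
theorem measureReal_exists_pair_le {n p : ℕ} (hn : 0 < n) {E ε q : ℝ} (hE : 0 ≤ E)
    (P : Config n → Config n → Prop)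
    (hcard : ∀ σ (A : Finset (Config n)), (∀ τ ∈ A, P σ τ) → (A.card : ℝ) ≤ Real.exp (ε * n))
    (hq : ∀ σ τ, P σ τ → overlap σ τ ^ p ≤ q) :
    (disorder n p).real {J | ∃ σ τ, P σ τ ∧ 2 * n * E ≤ energy J σ + energy J τ}
      ≤ Real.exp (n * (Real.log 2 + ε + E ^ 2 * q - E ^ 2)) := by
  classical
  have hsub : {J : Tensor n p | ∃ σ τ, P σ τ ∧ 2 * n * E ≤ energy J σ + energy J τ}
      ⊆ ⋃ σ ∈ (Finset.univ : Finset (Config n)), ⋃ τ ∈ Finset.univ.filter (P σ),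
        {J | 2 * n * E ≤ energy J σ + energy J τ} := by
    rintro J ⟨σ, τ, h1, h2⟩
    simp only [Finset.mem_univ, Set.iUnion_true, Set.mem_iUnion, Finset.mem_filter, true_and]
    exact ⟨σ, τ, h1, h2⟩
  calc _ ≤ _ := measureReal_mono hsub (measure_ne_top _ _)
    _ ≤ ∑ σ : Config n, ∑ τ ∈ Finset.univ.filter (P σ),
        (disorder n p).real {J | 2 * n * E ≤ energy J σ + energy J τ} :=
      (measureReal_biUnion_finset_le _ _).trans
        (Finset.sum_le_sum fun σ _ => measureReal_biUnion_finset_le _ _)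
    _ ≤ ∑ σ : Config n, ∑ τ ∈ Finset.univ.filter (P σ), Real.exp (n * (E ^ 2 * q - E ^ 2)) := by
      refine Finset.sum_le_sum fun σ _ => Finset.sum_le_sum fun τ hτ => ?_
      refine (measureReal_energy_add_ge_le hn hE σ τ).trans ?_
      have := hq σ τ (Finset.mem_filter.1 hτ).2
      gcongr
    _ ≤ ∑ σ : Config n, Real.exp (ε * n) * Real.exp (n * (E ^ 2 * q - E ^ 2)) := by
      refine Finset.sum_le_sum fun σ _ => ?_
      rw [Finset.sum_const, nsmul_eq_mul]
      gcongr
      exact hcard σ _ fun τ hτ => (Finset.mem_filter.1 hτ).2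
    _ = 2 ^ n * (Real.exp (ε * n) * Real.exp (n * (E ^ 2 * q - E ^ 2))) := by
      simp
    _ = _ := by
      have : (2 : ℝ) ^ n = Real.exp (n * Real.log 2) := by
        rw [Real.exp_nat_mul, Real.exp_log two_pos]
      rw [this, ← Real.exp_add, ← Real.exp_add]
      congr 1
      ring

/-! ### The truncated partition function -/

/-- The annealed partition function `𝔼 Z_β = 2^n exp(n β² / 2)`. -/
noncomputable def annealed (n : ℕ) (β : ℝ) : ℝ := 2 ^ n * Real.exp (n * β ^ 2 / 2)

theorem annealed_pos (n : ℕ) (β : ℝ) : 0 < annealed n β := by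
  unfold annealed; positivity

/-- The Boltzmann weight of `σ`, set to zero when the energy exceeds `n (β + η)`. -/
noncomputable def truncWeight {n p : ℕ} (β η : ℝ) (σ : Config n) (J : Tensor n p) : ℝ :=
  if energy J σ ≤ n * (β + η) then Real.exp (β * energy J σ) else 0

theorem truncWeight_nonneg {n p : ℕ} (β η : ℝ) (σ : Config n) (J : Tensor n p) :
    0 ≤ truncWeight β η σ J := by
  unfold truncWeight; split_ifs <;> positivity

theorem truncWeight_le {n p : ℕ} (β η : ℝ) (σ : Config n) (J : Tensor n p) :
    truncWeight β η σ J ≤ Real.exp (β * energy J σ) := by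
  unfold truncWeight; split_ifs
  · rfl
  · positivity

theorem measurable_truncWeight {n p : ℕ} (β η : ℝ) (σ : Config n) :
    Measurable fun J : Tensor n p => truncWeight β η σ J := by
  have h := measurable_energy (p := p) σ
  exact Measurable.ite (measurableSet_le h measurable_const) (by fun_prop) measurable_const

theorem integrable_truncWeight {n p : ℕ} (β η : ℝ) (σ : Config n) :
    Integrable (fun J : Tensor n p => truncWeight β η σ J) (disorder n p) :=
  (integrable_exp_energy β σ).mono' (measurable_truncWeight β η σ).aestronglyMeasurable
    (.of_forall fun J => by
      rw [Real.norm_of_nonneg (truncWeight_nonneg _ _ _ _)]; exact truncWeight_le _ _ _ _)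

theorem truncWeight_mul_le {n p : ℕ} (β η : ℝ) (σ τ : Config n) (J : Tensor n p) :
    truncWeight β η σ J * truncWeight β η τ J
      ≤ Real.exp (β * (energy J σ + energy J τ)) := by
  rw [mul_add, Real.exp_add]
  exact mul_le_mul (truncWeight_le _ _ _ _) (truncWeight_le _ _ _ _) (truncWeight_nonneg _ _ _ _)
    (Real.exp_pos _).le

theorem integrable_truncWeight_mul {n p : ℕ} (β η : ℝ) (σ τ : Config n) :
    Integrable (fun J : Tensor n p => truncWeight β η σ J * truncWeight β η τ J)
      (disorder n p) :=
  (integrable_exp_energy_add β σ τ).mono'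
    ((measurable_truncWeight β η σ).mul (measurable_truncWeight β η τ)).aestronglyMeasurable
    (.of_forall fun J => by
      rw [Real.norm_of_nonneg (mul_nonneg (truncWeight_nonneg _ _ _ _)
        (truncWeight_nonneg _ _ _ _))]
      exact truncWeight_mul_le _ _ _ _ _)

/-- Exponential tilting of a Boltzmann weight by a real `η` of either sign. -/
theorem integral_tilt {n p : ℕ} (hn : 0 < n) (β η : ℝ) (σ : Config n) :
    ∫ J : Tensor n p, Real.exp (-(n * η * (β + η))) * Real.exp ((β + η) * energy J σ)
      ∂disorder n p = Real.exp (n * β ^ 2 / 2) * Real.exp (-(n * η ^ 2 / 2)) := by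
  rw [integral_const_mul, integral_exp_energy hn, ← Real.exp_add, ← Real.exp_add]
  congr 1
  ring

/-- Where the weight is cut off, `η * energy` exceeds `n η (β + η)`, so the lost weight is dominated
by the tilted one, whose mean is smaller by `exp (-n η ^ 2 / 2)`. -/
theorem le_integral_truncWeight {n p : ℕ} (hn : 0 < n) {β η : ℝ} (hη : 0 ≤ η) (σ : Config n) :
    Real.exp (n * β ^ 2 / 2) * (1 - Real.exp (-(n * η ^ 2 / 2)))
      ≤ ∫ J : Tensor n p, truncWeight β η σ J ∂disorder n p := by
  have hi := (integrable_exp_energy (p := p) (β + η) σ).const_mul (Real.exp (-(n * η * (β + η))))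
  rw [mul_sub, mul_one, ← integral_tilt (p := p) hn β η σ, ← integral_exp_energy (p := p) hn β σ,
    ← integral_sub (integrable_exp_energy β σ) hi]
  refine integral_mono ((integrable_exp_energy β σ).sub hi) (integrable_truncWeight β η σ)
    fun J => ?_
  simp only [truncWeight]
  split_ifs with h
  · have : 0 ≤ Real.exp (-(n * η * (β + η))) * Real.exp ((β + η) * energy J σ) := by positivity
    linarith
  · rw [sub_nonpos, ← Real.exp_add, Real.exp_le_exp]
    have := mul_le_mul_of_nonneg_left (not_le.1 h).le hη
    linarith

theorem integral_truncWeight_mul_le {n p : ℕ} (hn : 0 < n) (β η : ℝ) (σ τ : Config n) :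
    ∫ J : Tensor n p, truncWeight β η σ J * truncWeight β η τ J ∂disorder n p
      ≤ Real.exp (n * β ^ 2) * Real.exp (n * β ^ 2 * |overlap σ τ| ^ p) := by
  calc _ ≤ ∫ J : Tensor n p, Real.exp (β * (energy J σ + energy J τ)) ∂disorder n p :=
        integral_mono (integrable_truncWeight_mul β η σ τ) (integrable_exp_energy_add β σ τ)
          fun J => truncWeight_mul_le β η σ τ J
    _ ≤ _ := by
        rw [integral_exp_energy_add hn, ← Real.exp_add, mul_add, mul_one]
        have : overlap σ τ ^ p ≤ |overlap σ τ| ^ p := by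
          rw [← abs_pow]; exact le_abs_self _
        gcongr

/-- Half of the exponent is replaced by the ceiling `n (β + η)` and only the other half is averaged.
At overlap near `1` the second factor improves from `exp (n β ^ 2)` to `exp (n (β ^ 2 / 2 + β η))`.
-/
theorem integral_truncWeight_mul_le_of_trunc {n p : ℕ} (hn : 0 < n) {β η : ℝ} (hβ : 0 ≤ β)
    (σ τ : Config n) :
    ∫ J : Tensor n p, truncWeight β η σ J * truncWeight β η τ J ∂disorder n p
      ≤ Real.exp (n * β ^ 2) * Real.exp (n * (β ^ 2 / 2 + β * η)) := by
  have hi := (integrable_exp_energy_add (p := p) (β / 2) σ τ).const_mul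
    (Real.exp (n * (β * (β + η))))
  calc _ ≤ ∫ J : Tensor n p, Real.exp (n * (β * (β + η)))
          * Real.exp (β / 2 * (energy J σ + energy J τ)) ∂disorder n p := by
        refine integral_mono (integrable_truncWeight_mul β η σ τ) hi fun J => ?_
        have hpos : 0 ≤ Real.exp (n * (β * (β + η)))
          * Real.exp (β / 2 * (energy J σ + energy J τ)) := by positivity
        simp only [truncWeight]
        split_ifs with h1 h2
        · rw [← Real.exp_add, ← Real.exp_add, Real.exp_le_exp]
          have := mul_le_mul_of_nonneg_left (add_le_add h1 h2) (by linarith : 0 ≤ β / 2)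
          linarith
        · simpa using hpos
        · simpa using hpos
        · simpa using hpos
    _ ≤ _ := by
        rw [integral_const_mul, integral_exp_energy_add hn, ← Real.exp_add, ← Real.exp_add,
          Real.exp_le_exp]
        have h1 : overlap σ τ ^ p ≤ 1 := by
          refine (le_abs_self _).trans ?_
          rw [abs_pow]
          exact pow_le_one₀ (abs_nonneg _) (abs_overlap_le_one σ τ)
        have h2 : (n : ℝ) * (β / 2) ^ 2 * (1 + overlap σ τ ^ p) ≤ n * (β / 2) ^ 2 * 2 := by
          gcongr
          linarith
        linarith

/-! ### Second moment -/

/-- The inner product takes at most `n + 1` values, and each level set has the Gaussian bound of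
`card_innerSum_eq_le`. -/
theorem sum_level_le {n : ℕ} (hn : 0 < n) (σ : Config n) (g : ℝ → ℝ) (K : ℝ)
    (hg : ∀ s, 0 ≤ g s) (hgK : ∀ s, g s * Real.exp (-(s ^ 2 / n) / 2) ≤ K) :
    ∑ τ, g (innerSum σ τ) ≤ 2 ^ n * ((n + 1) * K) := by
  have hmaps : ∀ τ ∈ (Finset.univ : Finset (Config n)),
      hammingDist σ τ ∈ Finset.range (n + 1) := fun τ _ => by
    have := hammingDist_le_card_fintype (x := σ) (y := τ)
    simp only [Fintype.card_fin] at this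
    exact Finset.mem_range.2 (by omega)
  rw [← Finset.sum_fiberwise_of_maps_to hmaps]
  calc _ ≤ ∑ d ∈ Finset.range (n + 1), 2 ^ n * K := by
        refine Finset.sum_le_sum fun d _ => ?_
        have hS : ∀ τ ∈ Finset.univ.filter (fun τ => hammingDist σ τ = d),
            innerSum σ τ = n - 2 * d := fun τ hτ => by
          rw [innerSum_eq_sub, (Finset.mem_filter.1 hτ).2]
        rw [Finset.sum_congr rfl fun τ hτ => by rw [hS τ hτ], Finset.sum_const, nsmul_eq_mul]
        have hc := card_innerSum_eq_le hn _ σ _ hS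
        calc _ ≤ 2 ^ n * Real.exp (-(((n : ℝ) - 2 * d) ^ 2 / n) / 2) * g (n - 2 * d) := by
              gcongr
              exact hg _
          _ = 2 ^ n * (g (n - 2 * d) * Real.exp (-(((n : ℝ) - 2 * d) ^ 2 / n) / 2)) := by ring
          _ ≤ _ := by gcongr; exact hgK _
    _ = _ := by
        rw [Finset.sum_const, Finset.card_range, nsmul_eq_mul]
        push_cast
        ring

theorem pow_three_mul_exp_le {u : ℝ} (hu : 0 ≤ u) :
    u ^ 3 * Real.exp (u / 8) * Real.exp (-u / 2) ≤ 384 := by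
  have h := Real.pow_div_factorial_le_exp (u / 4) (by positivity) 3
  have h6 : ((Nat.factorial 3 : ℕ) : ℝ) = 6 := by norm_num [Nat.factorial]
  rw [h6] at h
  have h1 : u ^ 3 ≤ 384 * Real.exp (u / 4) := by
    have : (u / 4) ^ 3 / 6 = u ^ 3 / 384 := by ring
    rw [this] at h
    linarith
  calc _ ≤ 384 * Real.exp (u / 4) * Real.exp (u / 8) * Real.exp (-u / 2) := by gcongr
    _ = 384 * Real.exp (-(u / 8)) := by
        rw [mul_assoc, mul_assoc, ← Real.exp_add, ← Real.exp_add]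
        ring_nf
    _ ≤ 384 * 1 := by
        gcongr
        exact Real.exp_le_one_iff.2 (by linarith)
    _ = 384 := by norm_num

/-- Six powers of `R` are set aside, since `n R ^ 6 = (n R ^ 2) ^ 3 / n ^ 2`: the factor `1 / n ^ 2`
outweighs the `n + 1` levels. The remaining `R ^ (p - 6)` keeps the exponent below `n R ^ 2 / 8`,
which the Gaussian level bound absorbs. -/
theorem exp_overlap_pow_le {n p : ℕ} (hn : 0 < n) {β r R : ℝ} (hr1 : r ≤ 1)
    (hp : 6 ≤ p) (hpr : β ^ 2 * r ^ (p - 6) ≤ 1 / 8) (hR : |R| ≤ r) :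
    Real.exp (n * β ^ 2 * |R| ^ p)
      ≤ 1 + ((n * R ^ 2) ^ 3 * Real.exp (n * R ^ 2 / 8)) / n ^ 2 := by
  have hn' : (0 : ℝ) < n := by exact_mod_cast hn
  have hR6 : |R| ^ 6 = R ^ 6 := by
    rw [← abs_pow]; exact abs_of_nonneg (by positivity)
  have hx : β ^ 2 * |R| ^ p ≤ R ^ 6 / 8 := by
    calc β ^ 2 * |R| ^ p = β ^ 2 * |R| ^ (p - 6) * R ^ 6 := by
          rw [← hR6, mul_assoc, ← pow_add, Nat.sub_add_cancel hp]
      _ ≤ β ^ 2 * r ^ (p - 6) * R ^ 6 := by gcongr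
      _ ≤ 1 / 8 * R ^ 6 := by gcongr
      _ = _ := by ring
  have hR2 : R ^ 6 ≤ R ^ 2 := by
    have h1 : R ^ 2 ≤ 1 := by
      rw [sq_le_one_iff_abs_le_one]; exact hR.trans hr1
    have : (R ^ 2) ^ 3 ≤ R ^ 2 := pow_le_of_le_one (by positivity) h1 (by norm_num)
    calc R ^ 6 = (R ^ 2) ^ 3 := by ring
      _ ≤ _ := this
  set x := n * β ^ 2 * |R| ^ p with hxdef
  have hx0 : 0 ≤ x := by positivity
  have hxa : x ≤ n * R ^ 6 := by
    rw [hxdef, mul_assoc]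
    have : 0 ≤ R ^ 6 := by positivity
    gcongr
    linarith
  have hxb : x ≤ n * R ^ 2 / 8 := by
    rw [hxdef, mul_assoc, mul_div_assoc]
    gcongr
    linarith
  -- This is `1 - x ≤ exp (-x)` multiplied by `exp x`.
  have hexp : Real.exp x ≤ 1 + x * Real.exp x := by
    have := Real.add_one_le_exp (-x)
    have h2 : (-x + 1) * Real.exp x ≤ Real.exp (-x) * Real.exp x := by gcongr
    rw [← Real.exp_add, neg_add_cancel, Real.exp_zero] at h2
    linarith
  refine hexp.trans ?_
  gcongr
  calc x * Real.exp x ≤ n * R ^ 6 * Real.exp (n * R ^ 2 / 8) := by gcongr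
    _ = _ := by field_simp

/-- The relative excess of the truncated second moment over the squared first moment. -/
noncomputable def momentExcess (a : ℝ) (n : ℕ) : ℝ :=
  384 * ((n : ℝ) + 1) / n ^ 2 + 2 * Real.exp (-(a * n))

/-- Pairs with `|R| ≤ r` give the squared mean up to `O(1 / n)`. For the others, close or nearly
antipodal, the truncated bound multiplied by their number is `exp (-a n)` relative to it. -/
theorem sum_integral_truncWeight_mul_le {n p : ℕ} (hn : 0 < n) {β η r a : ℝ} (hβ : 0 ≤ β)
    (hr1 : r ≤ 1) (hp : 6 ≤ p) (hpr : β ^ 2 * r ^ (p - 6) ≤ 1 / 8)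
    (hcard : ∀ (σ : Config n) (A : Finset (Config n)) (u : ℝ), (u = 1 ∨ u = -1) →
      (∀ τ ∈ A, r * n ≤ u * innerSum σ τ) →
      (A.card : ℝ) ≤ Real.exp ((Real.log 2 - β ^ 2 / 2 - β * η - a) * n)) (σ : Config n) :
    ∑ τ, ∫ J : Tensor n p, truncWeight β η σ J * truncWeight β η τ J ∂disorder n p
      ≤ 2 ^ n * Real.exp (n * β ^ 2) * (1 + momentExcess a n) := by
  classical
  have hn' : (0 : ℝ) < n := by exact_mod_cast hn
  set g : ℝ → ℝ := fun s => ((s ^ 2 / n) ^ 3 * Real.exp (s ^ 2 / n / 8)) / n ^ 2 with hg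
  set D : ℝ := Real.exp (n * (β ^ 2 / 2 + β * η)) with hD
  have hg0 : ∀ s, 0 ≤ g s := fun s => by rw [hg]; positivity
  have hterm : ∀ τ, ∫ J : Tensor n p, truncWeight β η σ J * truncWeight β η τ J ∂disorder n p
      ≤ Real.exp (n * β ^ 2) * (1 + g (innerSum σ τ)
        + (if r * n ≤ 1 * innerSum σ τ then D else 0)
        + (if r * n ≤ -1 * innerSum σ τ then D else 0)) := by
    intro τ
    have hD0 : 0 < D := Real.exp_pos _
    have hi0 : ∀ q : Prop, ∀ [Decidable q], (0 : ℝ) ≤ if q then D else 0 := fun q _ => by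
      split_ifs <;> positivity
    by_cases hR : |overlap σ τ| ≤ r
    · refine (integral_truncWeight_mul_le hn β η σ τ).trans ?_
      have h1 := exp_overlap_pow_le hn hr1 hp hpr hR
      have h2 : (n : ℝ) * overlap σ τ ^ 2 = innerSum σ τ ^ 2 / n := by
        rw [overlap]; field_simp
      rw [h2] at h1
      have h3 := hi0 (r * n ≤ 1 * innerSum σ τ)
      have h4 := hi0 (r * n ≤ -1 * innerSum σ τ)
      gcongr
      simp only [hg]
      linarith
    · refine (integral_truncWeight_mul_le_of_trunc hn hβ σ τ).trans ?_
      have h0 := hg0 (innerSum σ τ)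
      have h3 := hi0 (r * n ≤ 1 * innerSum σ τ)
      have h4 := hi0 (r * n ≤ -1 * innerSum σ τ)
      gcongr
      rw [not_le, overlap, abs_div, Nat.abs_cast, lt_div_iff₀ hn', lt_abs] at hR
      rcases hR with hR | hR
      · rw [if_pos (show r * n ≤ 1 * innerSum σ τ by linarith)]
        linarith
      · rw [if_pos (show r * n ≤ -1 * innerSum σ τ by linarith)]
        linarith
  have hfar : ∀ u : ℝ, (u = 1 ∨ u = -1) →
      ∑ τ, (if r * n ≤ u * innerSum σ τ then D else 0) ≤ 2 ^ n * Real.exp (-(a * n)) := by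
    intro u hu
    rw [← Finset.sum_filter, Finset.sum_const, nsmul_eq_mul]
    have h := hcard σ (Finset.univ.filter fun τ => r * n ≤ u * innerSum σ τ) u hu
      fun τ hτ => (Finset.mem_filter.1 hτ).2
    calc _ ≤ Real.exp ((Real.log 2 - β ^ 2 / 2 - β * η - a) * n) * D := by gcongr
      _ = Real.exp (n * Real.log 2) * Real.exp (-(a * n)) := by
        rw [hD, ← Real.exp_add, ← Real.exp_add]
        ring_nf
      _ = _ := by rw [Real.exp_nat_mul, Real.exp_log two_pos]
  have hlev : ∑ τ, g (innerSum σ τ) ≤ 2 ^ n * ((n + 1) * (384 / n ^ 2)) := by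
    refine sum_level_le hn σ g _ hg0 fun s => ?_
    have := pow_three_mul_exp_le (u := s ^ 2 / n) (by positivity)
    calc g s * Real.exp (-(s ^ 2 / n) / 2)
        = (s ^ 2 / n) ^ 3 * Real.exp (s ^ 2 / n / 8) * Real.exp (-(s ^ 2 / n) / 2) / n ^ 2 := by
          simp only [hg]; ring
      _ ≤ _ := by gcongr
  calc _ ≤ ∑ τ, Real.exp (n * β ^ 2) * (1 + g (innerSum σ τ)
        + (if r * n ≤ 1 * innerSum σ τ then D else 0)
        + (if r * n ≤ -1 * innerSum σ τ then D else 0)) := Finset.sum_le_sum fun τ _ => hterm τ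
    _ = Real.exp (n * β ^ 2) * (2 ^ n + ∑ τ, g (innerSum σ τ)
        + ∑ τ, (if r * n ≤ 1 * innerSum σ τ then D else 0)
        + ∑ τ, (if r * n ≤ -1 * innerSum σ τ then D else 0)) := by
      rw [← Finset.mul_sum, Finset.sum_add_distrib, Finset.sum_add_distrib,
        Finset.sum_add_distrib]
      simp
    _ ≤ Real.exp (n * β ^ 2) * (2 ^ n + 2 ^ n * ((n + 1) * (384 / n ^ 2))
        + 2 ^ n * Real.exp (-(a * n)) + 2 ^ n * Real.exp (-(a * n))) := by
      gcongr
      · exact hfar 1 (.inl rfl)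
      · exact hfar (-1) (.inr rfl)
    _ = _ := by rw [momentExcess]; ring

theorem partitionFunction_eq {n p : ℕ} (β : ℝ) (J : Tensor n p) :
    partitionFunction β J = ∑ σ, Real.exp (β * energy J σ) := by
  simp only [partitionFunction, energy, mul_assoc]

/-- Chebyshev's inequality for the truncated sum, centred at the annealed value rather than at its
own mean; the shift costs only the term `2 exp (-n η ^ 2 / 2)`. -/
theorem measureReal_partitionFunction_lt_le {n p : ℕ} (hn : 0 < n) {β η r a : ℝ} (hβ : 0 ≤ β)
    (hη : 0 ≤ η) (hr1 : r ≤ 1) (hp : 6 ≤ p) (hpr : β ^ 2 * r ^ (p - 6) ≤ 1 / 8)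
    (hcard : ∀ (σ : Config n) (A : Finset (Config n)) (u : ℝ), (u = 1 ∨ u = -1) →
      (∀ τ ∈ A, r * n ≤ u * innerSum σ τ) →
      (A.card : ℝ) ≤ Real.exp ((Real.log 2 - β ^ 2 / 2 - β * η - a) * n)) :
    (disorder n p).real {J | partitionFunction β J < annealed n β / 2}
      ≤ 4 * (momentExcess a n + 2 * Real.exp (-(n * η ^ 2 / 2))) := by
  set M := annealed n β with hM
  have hM0 : 0 < M := annealed_pos n β
  set Z : Tensor n p → ℝ := fun J => ∑ σ, truncWeight β η σ J with hZ
  have hZi : Integrable Z (disorder n p) :=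
    integrable_finsetSum _ fun σ _ => integrable_truncWeight β η σ
  have hZZ : ∀ J, Z J ^ 2 = ∑ σ, ∑ τ, truncWeight β η σ J * truncWeight β η τ J := fun J => by
    rw [sq, hZ, Finset.sum_mul_sum]
  have hZ2i : Integrable (fun J => Z J ^ 2) (disorder n p) := by
    simp only [hZZ]
    exact integrable_finsetSum _ fun σ _ => integrable_finsetSum _ fun τ _ =>
      integrable_truncWeight_mul β η σ τ
  have h2 : ∫ J, Z J ^ 2 ∂disorder n p ≤ M ^ 2 * (1 + momentExcess a n) := by
    simp only [hZZ]
    rw [integral_finsetSum _ fun σ _ => integrable_finsetSum _ fun τ _ =>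
      integrable_truncWeight_mul β η σ τ]
    calc _ ≤ ∑ σ : Config n, 2 ^ n * Real.exp (n * β ^ 2) * (1 + momentExcess a n) := by
          refine Finset.sum_le_sum fun σ _ => ?_
          rw [integral_finsetSum _ fun τ _ => integrable_truncWeight_mul β η σ τ]
          exact sum_integral_truncWeight_mul_le hn hβ hr1 hp hpr hcard σ
      _ = _ := by
          have : Real.exp (n * β ^ 2) = Real.exp (n * β ^ 2 / 2) ^ 2 := by
            rw [← Real.exp_nat_mul]; congr 1; push_cast; ring
          rw [hM, annealed, Finset.sum_const, this]
          simp
          ring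
  have h1 : M * (1 - Real.exp (-(n * η ^ 2 / 2))) ≤ ∫ J, Z J ∂disorder n p := by
    rw [integral_finsetSum _ fun σ _ => integrable_truncWeight β η σ]
    calc _ = ∑ σ : Config n, Real.exp (n * β ^ 2 / 2) * (1 - Real.exp (-(n * η ^ 2 / 2))) := by
          rw [hM, annealed, Finset.sum_const]
          simp
          ring
      _ ≤ _ := Finset.sum_le_sum fun σ _ => le_integral_truncWeight hn hη σ
  have hvi : Integrable (fun J => (Z J - M) ^ 2) (disorder n p) := by
    have : (fun J => (Z J - M) ^ 2) = fun J => Z J ^ 2 - 2 * M * Z J + M ^ 2 := by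
      ext J; ring
    rw [this]
    exact (hZ2i.sub (hZi.const_mul _)).add (integrable_const _)
  have hv : ∫ J, (Z J - M) ^ 2 ∂disorder n p
      ≤ M ^ 2 * (momentExcess a n + 2 * Real.exp (-(n * η ^ 2 / 2))) := by
    have : (fun J => (Z J - M) ^ 2) = fun J => Z J ^ 2 - 2 * M * Z J + M ^ 2 := by
      ext J; ring
    have hi : ∫ J, (Z J ^ 2 - 2 * M * Z J + M ^ 2) ∂disorder n p
        = ∫ J, Z J ^ 2 ∂disorder n p - 2 * M * ∫ J, Z J ∂disorder n p + M ^ 2 := by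
      rw [integral_add (f := fun J => Z J ^ 2 - 2 * M * Z J) (hZ2i.sub (hZi.const_mul _))
        (integrable_const _), integral_sub hZ2i (hZi.const_mul _), integral_const_mul,
        integral_const]
      simp
    rw [this, hi]
    have := mul_le_mul_of_nonneg_left h1 (by positivity : 0 ≤ 2 * M)
    nlinarith
  have hsub : {J : Tensor n p | partitionFunction β J < M / 2}
      ⊆ {J | M ^ 2 / 4 ≤ (Z J - M) ^ 2} := by
    intro J hJ
    have hle : Z J ≤ partitionFunction β J := by
      rw [partitionFunction_eq]
      exact Finset.sum_le_sum fun σ _ => truncWeight_le β η σ J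
    simp only [Set.mem_ofPred_eq] at hJ ⊢
    have : M / 2 ≤ M - Z J := by linarith
    nlinarith
  have hmk := mul_meas_ge_le_integral_of_nonneg (μ := disorder n p)
    (f := fun J => (Z J - M) ^ 2) (.of_forall fun J => sq_nonneg _) hvi (M ^ 2 / 4)
  refine (measureReal_mono hsub).trans ?_
  have h5 := hmk.trans hv
  have h6 : M ^ 2 * (disorder n p).real {J | M ^ 2 / 4 ≤ (Z J - M) ^ 2}
      ≤ M ^ 2 * (4 * (momentExcess a n + 2 * Real.exp (-(n * η ^ 2 / 2)))) := by linarith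
  exact le_of_mul_le_mul_left h6 (by positivity)

/-! ### The mass outside the energy band -/

theorem measureReal_outside_le {n p : ℕ} (hn : 0 < n) {β η : ℝ} (hη : 0 ≤ η) :
    (disorder n p).real {J | annealed n β * Real.exp (-(n * η ^ 2 / 4))
        ≤ ∑ σ with ¬ |hamiltonian J σ - β| ≤ η, Real.exp (β * energy J σ)}
      ≤ 2 * Real.exp (-(n * η ^ 2 / 4)) := by
  have hn' : (0 : ℝ) < n := by exact_mod_cast hn
  set M := annealed n β with hM
  have hM0 : 0 < M := annealed_pos n β
  -- `T η` dominates the Boltzmann weight above the band and `T (-η)` below it.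
  set T : ℝ → Config n → Tensor n p → ℝ := fun t σ J =>
    Real.exp (-(n * t * (β + t))) * Real.exp ((β + t) * energy J σ) with hT
  have hTi : ∀ t σ, Integrable (T t σ) (disorder n p) := fun t σ =>
    (integrable_exp_energy _ σ).const_mul _
  have hT0 : ∀ t σ J, 0 ≤ T t σ J := fun t σ J => by simp only [hT]; positivity
  set G : Tensor n p → ℝ := fun J => ∑ σ, (T η σ J + T (-η) σ J) with hG
  have hGi : Integrable G (disorder n p) :=
    integrable_finsetSum _ fun σ _ => (hTi η σ).add (hTi (-η) σ)
  have hmean : ∫ J, G J ∂disorder n p = M * (2 * Real.exp (-(n * η ^ 2 / 2))) := by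
    rw [integral_finsetSum (f := fun σ J => T η σ J + T (-η) σ J) _
      fun σ _ => (hTi η σ).add (hTi (-η) σ)]
    have : ∀ σ, ∫ J, (T η σ J + T (-η) σ J) ∂disorder n p
        = Real.exp (n * β ^ 2 / 2) * (2 * Real.exp (-(n * η ^ 2 / 2))) := fun σ => by
      rw [integral_add (hTi η σ) (hTi (-η) σ), hT, integral_tilt hn, integral_tilt hn, neg_sq]
      ring
    simp only [this]
    rw [hM, annealed, Finset.sum_const]
    simp
    ring
  have hle : ∀ J : Tensor n p,
      ∑ σ with ¬ |hamiltonian J σ - β| ≤ η, Real.exp (β * energy J σ) ≤ G J := by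
    intro J
    refine (Finset.sum_le_sum fun σ hσ => ?_).trans (Finset.sum_le_sum_of_subset_of_nonneg
      (Finset.filter_subset _ _) fun σ _ _ => add_nonneg (hT0 η σ J) (hT0 (-η) σ J))
    have hσ' := (Finset.mem_filter.1 hσ).2
    rw [not_le, lt_abs] at hσ'
    rcases hσ' with h | h
    · refine le_trans ?_ (le_add_of_nonneg_right (hT0 (-η) σ J))
      simp only [hT]
      rw [← Real.exp_add, Real.exp_le_exp, energy]
      have := mul_le_mul_of_nonneg_left h.le (mul_nonneg hn'.le hη)
      linarith
    · refine le_trans ?_ (le_add_of_nonneg_left (hT0 η σ J))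
      simp only [hT]
      rw [← Real.exp_add, Real.exp_le_exp, energy]
      have := mul_le_mul_of_nonneg_left h.le (mul_nonneg hn'.le hη)
      linarith
  have hmk := mul_meas_ge_le_integral_of_nonneg (μ := disorder n p) (f := G)
    (.of_forall fun J => Finset.sum_nonneg fun σ _ => add_nonneg (hT0 η σ J) (hT0 (-η) σ J)) hGi
    (M * Real.exp (-(n * η ^ 2 / 4)))
  have hsub : {J | M * Real.exp (-(n * η ^ 2 / 4))
        ≤ ∑ σ with ¬ |hamiltonian J σ - β| ≤ η, Real.exp (β * energy J σ)}
      ⊆ {J : Tensor n p | M * Real.exp (-(n * η ^ 2 / 4)) ≤ G J} :=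
    fun J hJ => le_trans hJ (hle J)
  refine (measureReal_mono hsub).trans ?_
  rw [hmean] at hmk
  -- Markov's inequality splits the decay evenly between the threshold and the probability.
  have h2 : Real.exp (-(n * η ^ 2 / 2))
      = Real.exp (-(n * η ^ 2 / 4)) * Real.exp (-(n * η ^ 2 / 4)) := by
    rw [← Real.exp_add]; congr 1; ring
  rw [h2] at hmk
  refine le_of_mul_le_mul_left (a := M * Real.exp (-(n * η ^ 2 / 4))) ?_ (by positivity)
  linarith

/-! ### Clusterings -/

/-- A set without pairs at intermediate distance splits into clusters. -/
theorem exists_isClustering {n : ℕ} (hn : 0 < n) {ν₁ ν₂ : ℝ} (h1 : 0 < ν₁) (h2 : ν₁ < ν₂ / 2)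
    (A : Finset (Config n))
    (hA : ∀ σ ∈ A, ∀ τ ∈ A, ¬ (ν₁ * n < hammingDist σ τ ∧ (hammingDist σ τ : ℝ) < ν₂ * n)) :
    ∃ (L : ℕ) (C : Fin L → Finset (Config n)), IsClustering ν₁ ν₂ A C := by
  classical
  have hn' : (0 : ℝ) < n := by exact_mod_cast hn
  have hν : ν₁ * n + ν₁ * n < ν₂ * n := by nlinarith
  have hclose : ∀ σ ∈ A, ∀ τ ∈ A, (hammingDist σ τ : ℝ) < ν₂ * n →
      (hammingDist σ τ : ℝ) ≤ ν₁ * n := fun σ hσ τ hτ h => by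
    by_contra hc
    exact hA σ hσ τ hτ ⟨not_le.1 hc, h⟩
  -- Two short steps stay below `2 ν₁ n < ν₂ n`, and the gap then forces the distance down to `ν₁
  -- n`. Hence closeness is transitive on `A`, and the clusters are its classes.
  have htrans : ∀ σ ∈ A, ∀ τ, ∀ ρ ∈ A, (hammingDist σ τ : ℝ) ≤ ν₁ * n →
      (hammingDist τ ρ : ℝ) ≤ ν₁ * n → (hammingDist σ ρ : ℝ) ≤ ν₁ * n := by
    intro σ hσ τ ρ hρ ha hb
    refine hclose σ hσ ρ hρ ?_
    have : (hammingDist σ ρ : ℝ) ≤ hammingDist σ τ + hammingDist τ ρ := by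
      exact_mod_cast hammingDist_triangle σ τ ρ
    linarith
  set cls : Config n → Finset (Config n) := fun σ =>
    A.filter fun τ => (hammingDist σ τ : ℝ) ≤ ν₁ * n with hcls
  have hmem : ∀ {σ τ}, τ ∈ cls σ ↔ τ ∈ A ∧ (hammingDist σ τ : ℝ) ≤ ν₁ * n := by
    simp [hcls]
  have hself : ∀ σ ∈ A, σ ∈ cls σ := fun σ hσ => hmem.2 ⟨hσ, by simp; positivity⟩
  have hC : ∀ i, ∃ σ ∈ A, cls σ = ((A.image cls).equivFin.symm i : Finset (Config n)) := fun i =>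
    Finset.mem_image.1 ((A.image cls).equivFin.symm i).2
  have hcls_eq : ∀ σ ∈ A, ∀ σ' ∈ A, ∀ τ ∈ cls σ, ∀ τ' ∈ cls σ',
      (hammingDist τ τ' : ℝ) < ν₂ * n → cls σ ⊆ cls σ' := by
    intro σ hσ σ' hσ' τ hτ τ' hτ' hd ρ hρ
    rw [hmem] at hτ hτ' hρ ⊢
    have e1 : (hammingDist σ' τ : ℝ) ≤ ν₁ * n :=
      htrans σ' hσ' τ' τ hτ.1 hτ'.2 (by
        rw [hammingDist_comm]; exact hclose τ hτ.1 τ' hτ'.1 hd)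
    have e2 : (hammingDist σ' σ : ℝ) ≤ ν₁ * n :=
      htrans σ' hσ' τ σ hσ e1 (by rw [hammingDist_comm]; exact hτ.2)
    exact ⟨hρ.1, htrans σ' hσ' σ ρ hρ.1 e2 hρ.2⟩
  have hbetween : ∀ i j, i ≠ j → ∀ σ ∈ ((A.image cls).equivFin.symm i : Finset (Config n)),
      ∀ σ' ∈ ((A.image cls).equivFin.symm j : Finset (Config n)),
      ν₂ * n ≤ (hammingDist σ σ' : ℝ) := by
    intro i j hij τ hτ τ' hτ'
    obtain ⟨σ, hσ, hi⟩ := hC i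
    obtain ⟨σ', hσ', hj⟩ := hC j
    by_contra hc
    rw [not_le] at hc
    rw [← hi] at hτ
    rw [← hj] at hτ'
    refine hij ((A.image cls).equivFin.symm.injective (Subtype.ext ?_))
    rw [← hi, ← hj]
    exact Finset.Subset.antisymm (hcls_eq σ hσ σ' hσ' τ hτ τ' hτ' hc)
      (hcls_eq σ' hσ' σ hσ τ' hτ' τ hτ (by rwa [hammingDist_comm]))
  refine ⟨(A.image cls).card, fun i => ((A.image cls).equivFin.symm i : Finset (Config n)),
    ?_, ?_, ?_, ?_, hbetween⟩
  · intro i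
    obtain ⟨σ, hσ, hi⟩ := hC i
    exact ⟨σ, hi ▸ hself σ hσ⟩
  · intro i j hij
    rw [Finset.disjoint_left]
    intro σ hσ hσ'
    -- A common point would be at distance at least `ν₂ n > 0` from itself.
    have := hbetween i j hij σ hσ σ hσ'
    rw [hammingDist_self, Nat.cast_zero] at this
    nlinarith
  · ext σ
    simp only [Finset.mem_biUnion, Finset.mem_univ, true_and]
    constructor
    · rintro ⟨i, hi⟩
      obtain ⟨ρ, _, hρ'⟩ := hC i
      rw [← hρ', hmem] at hi
      exact hi.1
    · intro hσ
      refine ⟨(A.image cls).equivFin ⟨cls σ, Finset.mem_image_of_mem _ hσ⟩, ?_⟩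
      rw [Equiv.symm_apply_apply]
      exact hself σ hσ
  · intro i τ hτ τ' hτ'
    obtain ⟨σ, hσ, hi⟩ := hC i
    rw [← hi, hmem] at hτ hτ'
    exact htrans τ hτ.1 σ τ' hτ'.1 (by rw [hammingDist_comm]; exact hτ.2) hτ'.2

/-! ### From clusters of the energy band to shattering -/

theorem partitionFunction_pos {n p : ℕ} (β : ℝ) (J : Tensor n p) : 0 < partitionFunction β J :=
  Finset.sum_pos (fun _ _ => Real.exp_pos _) Finset.univ_nonempty

theorem gibbs_eq {n p : ℕ} (β : ℝ) (J : Tensor n p) (A : Finset (Config n)) :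
    gibbs β J A = (∑ σ ∈ A, Real.exp (β * energy J σ)) / partitionFunction β J := by
  simp only [gibbs, energy, mul_assoc]

theorem gibbs_energyBand_ge {n p : ℕ} {β κ D : ℝ} {J : Tensor n p}
    (hZ : annealed n β / 2 ≤ partitionFunction β J)
    (hout : ∑ σ with ¬ |hamiltonian J σ - β| ≤ κ * √(2 * Real.log 2), Real.exp (β * energy J σ)
      ≤ annealed n β * D) :
    1 - 2 * D ≤ gibbs β J (energyBand β κ J) := by
  have hM := annealed_pos n β
  have hZ0 := partitionFunction_pos β J
  have hsplit := Finset.sum_filter_add_sum_filter_not Finset.univ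
    (fun σ => |hamiltonian J σ - β| ≤ κ * √(2 * Real.log 2)) fun σ => Real.exp (β * energy J σ)
  rw [← partitionFunction_eq] at hsplit
  have hD : 0 ≤ D := by
    by_contra hD
    have h0 : 0 ≤ ∑ σ with ¬ |hamiltonian J σ - β| ≤ κ * √(2 * Real.log 2),
      Real.exp (β * energy J σ) := Finset.sum_nonneg fun _ _ => (Real.exp_pos _).le
    nlinarith [mul_neg_of_pos_of_neg hM (not_le.1 hD)]
  rw [gibbs_eq, energyBand, le_div_iff₀ hZ0]
  have := mul_le_mul_of_nonneg_right hZ (by linarith : 0 ≤ 2 * D)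
  linarith

/-- Number of points times the largest weight, divided by half the annealed value. -/
theorem gibbs_le_of_card_le {n p : ℕ} {β η ε : ℝ} (hβ : 0 ≤ β) {J : Tensor n p}
    (hZ : annealed n β / 2 ≤ partitionFunction β J) {A : Finset (Config n)}
    (hA : ∀ σ ∈ A, hamiltonian J σ ≤ β + η) (hcard : (A.card : ℝ) ≤ Real.exp (ε * n)) :
    gibbs β J A ≤ 2 * Real.exp (-((Real.log 2 - β ^ 2 / 2 - β * η - ε) * n)) := by
  have hM := annealed_pos n β
  have hsum : ∑ σ ∈ A, Real.exp (β * energy J σ)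
      ≤ Real.exp (ε * n) * Real.exp (n * (β * (β + η))) := by
    calc _ ≤ ∑ σ ∈ A, Real.exp (n * (β * (β + η))) := by
          refine Finset.sum_le_sum fun σ hσ => ?_
          have := hA σ hσ
          rw [energy, mul_left_comm]
          gcongr
      _ = A.card * Real.exp (n * (β * (β + η))) := by simp
      _ ≤ _ := by gcongr
  have h2 : (2 : ℝ) ^ n = Real.exp (n * Real.log 2) := by
    rw [Real.exp_nat_mul, Real.exp_log two_pos]
  rw [gibbs_eq, div_le_iff₀ (partitionFunction_pos β J)]
  calc _ ≤ _ := hsum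
    _ = 2 * Real.exp (-((Real.log 2 - β ^ 2 / 2 - β * η - ε) * n)) * (annealed n β / 2) := by
      rw [annealed, h2, ← Real.exp_add, ← Real.exp_add, mul_right_comm, mul_div_cancel₀ _
        two_ne_zero, ← Real.exp_add]
      congr 1
      ring
    _ ≤ _ := by gcongr

theorem isShatteredBy_of_isClustering {n p L : ℕ} (hn : 0 < n) {β κ ν₁ ν₂ a D : ℝ}
    (hβ : 0 ≤ β) (hν₁ : 0 < ν₁) (ha : 0 < a)
    (hball : ∀ (σ : Config n) (A : Finset (Config n)),
      (∀ τ ∈ A, (hammingDist σ τ : ℝ) ≤ ν₁ * n) →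
      (A.card : ℝ) ≤ Real.exp ((Real.log 2 - β ^ 2 / 2 - β * (κ * √(2 * Real.log 2)) - a) * n))
    (hD : D ≤ 1 / 4) (hna : 4 * Real.log 2 ≤ a * n) {J : Tensor n p}
    (hZ : annealed n β / 2 ≤ partitionFunction β J)
    (hout : ∑ σ with ¬ |hamiltonian J σ - β| ≤ κ * √(2 * Real.log 2), Real.exp (β * energy J σ)
      ≤ annealed n β * D)
    {C : Fin L → Finset (Config n)} (hC : IsClustering ν₁ ν₂ (energyBand β κ J) C) :
    IsShatteredBy β (2 * ν₁) ν₂ (a / (4 * Real.log 2)) (a / 2) (2 * D) J C := by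
  have hn' : (0 : ℝ) < n := by exact_mod_cast hn
  have hl2 : 0 < Real.log 2 := Real.log_pos one_lt_two
  have hcoll := gibbs_energyBand_ge hZ hout
  rw [← hC.union] at hcoll
  have hsub : ∀ i, gibbs β J (C i) ≤ Real.exp (-(a / 2) * n) := by
    intro i
    obtain ⟨σ, hσ⟩ := hC.nonempty i
    have h := gibbs_le_of_card_le (η := κ * √(2 * Real.log 2)) hβ hZ (A := C i)
      (fun τ hτ => by
        have : τ ∈ energyBand β κ J := by
          rw [← hC.union]; exact Finset.mem_biUnion.2 ⟨i, Finset.mem_univ _, hτ⟩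
        have := (abs_le.1 (Finset.mem_filter.1 this).2).2
        linarith)
      (hball σ (C i) fun τ hτ => hC.within i σ hσ τ hτ)
    refine h.trans ?_
    calc _ = Real.exp (Real.log 2 + -(a * n)) := by
          rw [Real.exp_add, Real.exp_log two_pos]
          ring_nf
      -- Half of the rate `a` absorbs the prefactor `2`, by `hna`.
      _ ≤ _ := Real.exp_le_exp.2 (by linarith)
  refine ⟨hC.nonempty, ?_, ?_, ?_, hsub, hcoll⟩
  · have hsum : gibbs β J (Finset.univ.biUnion C) ≤ L * Real.exp (-(a / 2) * n) := by
      rw [gibbs_eq, Finset.sum_biUnion fun i _ j _ hij => hC.disjoint i j hij, Finset.sum_div]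
      calc _ ≤ ∑ i : Fin L, Real.exp (-(a / 2) * n) :=
            Finset.sum_le_sum fun i _ => by rw [← gibbs_eq]; exact hsub i
        _ = _ := by simp
    -- Total mass at least `1 / 2` and clusters of mass at most `exp (-a n / 2)` give `L ≥ exp (a n
    -- / 2) / 2`; `hna` absorbs the `1 / 2`.
    have hL : Real.exp (a * n / 4) ≤ L := by
      have h1 : 1 / 2 ≤ L * Real.exp (-(a / 2) * n) := by linarith
      have h2 : Real.exp (a * n / 4) * Real.exp (-(a / 2) * n) ≤ 1 / 2 := by
        calc _ ≤ Real.exp (-Real.log 2) := by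
              rw [← Real.exp_add, Real.exp_le_exp]
              linarith
          _ = 1 / 2 := by rw [Real.exp_neg, Real.exp_log two_pos, one_div]
      exact le_of_mul_le_mul_right (h2.trans h1) (Real.exp_pos _)
    have hlog : a * n / 4 ≤ Real.log L := by
      rw [Real.le_log_iff_exp_le (lt_of_lt_of_le (Real.exp_pos _) hL)]
      exact hL
    rw [Real.logb, one_div, ← div_eq_inv_mul, le_div_iff₀ hn', le_div_iff₀ hl2]
    calc _ = a * n / 4 := by field_simp
      _ ≤ _ := hlog
  · intro i
    -- The diameter is a supremum in `ℕ`, so the real bound passes through its floor.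
    have h : diam (C i) ≤ ⌊ν₁ * n⌋₊ := by
      refine Finset.sup_le fun x hx => ?_
      rw [Finset.mem_product] at hx
      exact Nat.le_floor (hC.within i _ hx.1 _ hx.2)
    have h' : (diam (C i) : ℝ) ≤ ν₁ * n :=
      (Nat.cast_le.2 h).trans (Nat.floor_le (by positivity))
    nlinarith
  · intro i j hij
    obtain ⟨σ, hσ⟩ := hC.nonempty i
    obtain ⟨τ, hτ⟩ := hC.nonempty j
    -- Nonempty clusters make the infimum attained and rule out the default `sInf ∅ = 0`.
    obtain ⟨x, hx, y, hy, hxy⟩ := Nat.sInf_mem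
      (s := {d : ℕ | ∃ x ∈ C i, ∃ y ∈ C j, hammingDist x y = d}) ⟨_, σ, hσ, τ, hτ, rfl⟩
    rw [setDist, ← hxy]
    exact hC.between i j hij.ne x hx y hy

/-! ### Asymptotics -/

theorem tendsto_exp_neg_mul_natCast {a : ℝ} (ha : 0 < a) :
    Tendsto (fun n : ℕ => Real.exp (-(a * n))) atTop (𝓝 0) :=
  Real.tendsto_exp_neg_atTop_nhds_zero.comp
    (tendsto_natCast_atTop_atTop.const_mul_atTop ha)

theorem tendsto_momentExcess {a : ℝ} (ha : 0 < a) :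
    Tendsto (momentExcess a) atTop (𝓝 0) := by
  have h1 : Tendsto (fun n : ℕ => (n : ℝ)⁻¹) atTop (𝓝 0) := tendsto_inv_atTop_nhds_zero_nat
  have h2 : Tendsto (fun n : ℕ => 384 * ((n : ℝ)⁻¹ + (n : ℝ)⁻¹ * (n : ℝ)⁻¹)
      + 2 * Real.exp (-(a * n))) atTop (𝓝 (384 * (0 + 0 * 0) + 2 * 0)) :=
    ((h1.add (h1.mul h1)).const_mul _).add ((tendsto_exp_neg_mul_natCast ha).const_mul _)
  norm_num at h2
  refine h2.congr' ?_
  filter_upwards [eventually_gt_atTop 0] with n hn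
  have : (n : ℝ) ≠ 0 := by exact_mod_cast hn.ne'
  rw [momentExcess]
  field_simp

/-- Only subadditivity on `S ∪ Sᶜ` is used, so the shattering event need not be shown measurable. -/
theorem tendsto_measure_one {α : ℕ → Type*} [∀ n, MeasurableSpace (α n)]
    (μ : ∀ n, Measure (α n)) [∀ n, IsProbabilityMeasure (μ n)] (S : ∀ n, Set (α n)) (b : ℕ → ℝ)
    (hb : Tendsto b atTop (𝓝 0)) (h : ∀ᶠ n in atTop, (μ n).real (S n)ᶜ ≤ b n) :
    Tendsto (fun n => μ n (S n)) atTop (𝓝 1) := by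
  have hlow : Tendsto (fun n => ENNReal.ofReal (1 - b n)) atTop (𝓝 1) := by
    have := ENNReal.tendsto_ofReal (hb.const_sub 1)
    simpa using this
  refine tendsto_of_tendsto_of_tendsto_of_le_of_le' hlow tendsto_const_nhds ?_
    (.of_forall fun n => prob_le_one)
  filter_upwards [h] with n hn
  refine ENNReal.ofReal_le_of_le_toReal ?_
  have := measureReal_union_le (μ := μ n) (S n) (S n)ᶜ
  rw [Set.union_compl_self, probReal_univ] at this
  change 1 - b n ≤ (μ n).real (S n)
  linarith

theorem measureReal_not_shattered_le {n p : ℕ} (hn : 0 < n) {β κ ν₁ ν₂ a g : ℝ}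
    (hβ : 0 ≤ β) (hκ : 0 ≤ κ) (hE : 0 ≤ β - κ * √(2 * Real.log 2)) (hν₁ : 0 < ν₁)
    (hν : ν₁ < ν₂ / 2) (hν₂ : ν₂ ≤ 1 / 2) (ha : 0 < a)
    (hp : 6 ≤ p) (hpr : β ^ 2 * (1 - 2 * ν₂) ^ (p - 6) ≤ 1 / 8)
    (hcard : ∀ (σ : Config n) (A : Finset (Config n)) (u : ℝ), (u = 1 ∨ u = -1) →
      (∀ τ ∈ A, (1 - 2 * ν₂) * n ≤ u * innerSum σ τ) →
      (A.card : ℝ) ≤ Real.exp ((Real.log 2 - β ^ 2 / 2 - β * (κ * √(2 * Real.log 2)) - a) * n))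
    (hcard' : ∀ (σ : Config n) (A : Finset (Config n)),
      (∀ τ ∈ A, (1 - 2 * ν₂) * n ≤ 1 * innerSum σ τ) → (A.card : ℝ) ≤ Real.exp (g * n))
    (hg : Real.log 2 + g + (β - κ * √(2 * Real.log 2)) ^ 2 * (1 - 2 * ν₁) ^ p
      - (β - κ * √(2 * Real.log 2)) ^ 2 ≤ -g)
    (hD : Real.exp (-(n * (κ * √(2 * Real.log 2)) ^ 2 / 4)) ≤ 1 / 4)
    (hna : 4 * Real.log 2 ≤ a * n) :
    (disorder n p).real {J | ∃ (L : ℕ) (C : Fin L → Finset (Config n)),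
        IsShatteredBy β (2 * ν₁) ν₂ (a / (4 * Real.log 2)) (a / 2)
          (2 * Real.exp (-(n * (κ * √(2 * Real.log 2)) ^ 2 / 4))) J C ∧
        IsClustering ν₁ ν₂ (energyBand β κ J) C}ᶜ
      ≤ Real.exp (n * -g)
        + 4 * (momentExcess a n + 2 * Real.exp (-(n * (κ * √(2 * Real.log 2)) ^ 2 / 2)))
        + 2 * Real.exp (-(n * (κ * √(2 * Real.log 2)) ^ 2 / 4)) := by
  have hn' : (0 : ℝ) < n := by exact_mod_cast hn
  set η := κ * √(2 * Real.log 2) with hη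
  have hη0 : 0 ≤ η := by positivity
  set P : Config n → Config n → Prop := fun σ τ =>
    ν₁ * n < hammingDist σ τ ∧ (hammingDist σ τ : ℝ) < ν₂ * n with hP
  have b1 := measureReal_exists_pair_le (p := p) (q := (1 - 2 * ν₁) ^ p) hn hE P
    (fun σ A hA => hcard' σ A fun τ hτ => by
      have := (hA τ hτ).2
      rw [innerSum_eq_sub]
      linarith)
    (fun σ τ h => by
      have e1 := h.1
      have e2 := h.2
      -- The bound `ν₂ ≤ 1 / 2` makes these overlaps nonnegative, so the `p`-th power is monotone
      -- for either parity of `p`.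
      have e3 : ν₂ * n ≤ 1 / 2 * n := by gcongr
      refine pow_le_pow_left₀ ?_ ?_ p
      · rw [overlap, innerSum_eq_sub]
        exact div_nonneg (by linarith) hn'.le
      · rw [overlap, innerSum_eq_sub, div_le_iff₀ hn']
        linarith)
  have b2 := measureReal_partitionFunction_lt_le (p := p) hn hβ hη0
    (show 1 - 2 * ν₂ ≤ 1 by linarith) hp hpr hcard
  have b3 := measureReal_outside_le (p := p) hn (β := β) hη0
  have b1' := b1.trans (Real.exp_le_exp.2 (mul_le_mul_of_nonneg_left hg hn'.le))
  refine le_trans ?_ (add_le_add (add_le_add b1' b2) b3)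
  refine le_trans (measureReal_mono ?_) ((measureReal_union_le _ _).trans
    (add_le_add (measureReal_union_le _ _) le_rfl))
  intro J hJ
  by_contra hnot
  simp only [Set.mem_union, not_or] at hnot
  obtain ⟨⟨n1, n2⟩, n3⟩ := hnot
  have n2' : annealed n β / 2 ≤ partitionFunction β J := not_lt.1 n2
  rw [Set.mem_ofPred_eq, not_le] at n3
  refine hJ ?_
  obtain ⟨L, C, hC⟩ := exists_isClustering hn hν₁ hν (energyBand β κ J) fun σ hσ τ hτ hst => by
    refine n1 ⟨σ, τ, hst, ?_⟩
    have e1 := (abs_le.1 (Finset.mem_filter.1 hσ).2).1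
    have e2 := (abs_le.1 (Finset.mem_filter.1 hτ).2).1
    rw [energy, energy]
    have := mul_le_mul_of_nonneg_left (add_le_add e1 e2) hn'.le
    linarith
  refine ⟨L, C, isShatteredBy_of_isClustering hn hβ hν₁ ha (fun σ A hA => ?_) hD hna n2' n3.le hC,
    hC⟩
  refine hcard σ A 1 (.inl rfl) fun τ hτ => ?_
  have e1 := hA τ hτ
  have e3 : ν₁ * n ≤ ν₂ * n := by
    have : ν₁ ≤ ν₂ := by linarith
    gcongr
  rw [innerSum_eq_sub]
  linarith

end IsingPSpin

/-! ### Choice of the constants -/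

open MeasureTheory Filter Topology IsingPSpin

theorem mainTheorem1 (β : ℝ) (hβ₁ : √(Real.log 2) < β) (hβ₂ : β < √(2 * Real.log 2)) :
    ∃ κ₀ : ℝ, 0 < κ₀ ∧ ∀ κ : ℝ, 0 < κ → κ < κ₀ →
      ∃ (P : ℕ) (ν₁ ν₂ c c' : ℝ),
        0 < ν₁ ∧ ν₁ < ν₂ / 2 ∧ ν₂ < 1 ∧ 0 < c ∧ 0 < c' ∧
        ∀ p : ℕ, P ≤ p →
          ∃ δ : ℕ → ℝ, Filter.Tendsto δ Filter.atTop (nhds 0) ∧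
            Filter.Tendsto
              (fun n : ℕ => IsingPSpin.disorder n p
                {J | ∃ (L : ℕ) (C : Fin L → Finset (IsingPSpin.Config n)),
                  IsingPSpin.IsShatteredBy β (2 * ν₁) ν₂ c c' (δ n) J C ∧
                  IsingPSpin.IsClustering ν₁ ν₂ (IsingPSpin.energyBand β κ J) C})
              Filter.atTop (nhds 1) := by
  have hl2 : 0 < Real.log 2 := Real.log_pos one_lt_two
  have hs : 0 < √(2 * Real.log 2) := Real.sqrt_pos.2 (by positivity)
  have hβ : 0 < β := (Real.sqrt_nonneg _).trans_lt hβ₁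
  have hβsq : β ^ 2 < 2 * Real.log 2 := (Real.lt_sqrt hβ.le).1 hβ₂
  have hgap : 0 < Real.log 2 - β ^ 2 / 2 := by linarith
  -- The first bound gives `(β - η) ^ 2 > log 2`, needed for the gap; the second gives `β η < log 2
  -- - β ^ 2 / 2`, needed for the truncated second moment and for small clusters.
  refine ⟨min (β - √(Real.log 2)) ((Real.log 2 - β ^ 2 / 2) / β) / √(2 * Real.log 2),
    div_pos (lt_min (by linarith) (by positivity)) hs, fun κ hκ hκ₀ => ?_⟩
  rw [lt_div_iff₀ hs, lt_min_iff, lt_div_iff₀ hβ] at hκ₀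
  obtain ⟨hκ1, hκ2⟩ := hκ₀
  set η := κ * √(2 * Real.log 2) with hη
  have hη0 : 0 < η := by positivity
  have hE : √(Real.log 2) < β - η := by linarith
  have hE0 : 0 < β - η := (Real.sqrt_nonneg _).trans_lt hE
  have hEsq : Real.log 2 < (β - η) ^ 2 := (Real.sqrt_lt' hE0).1 hE
  -- One third of the gap pays for the ball's entropy, one for the correlation term, and one remains
  -- as decay rate.
  obtain ⟨g, hg⟩ : ∃ g, g = ((β - η) ^ 2 - Real.log 2) / 3 := ⟨_, rfl⟩
  -- Half of the margin is the entropy allowed to a ball, half the resulting rate.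
  obtain ⟨a, ha⟩ : ∃ a, a = (Real.log 2 - β ^ 2 / 2 - β * η) / 2 := ⟨_, rfl⟩
  have hg0 : 0 < g := by rw [hg]; linarith
  have ha0 : 0 < a := by rw [ha]; linarith
  obtain ⟨ν, hν0, hν⟩ := exists_card_innerSum_le (min g a) (lt_min hg0 ha0)
  set ν₂ := min ν (1 / 4) with hν₂
  have hν₂0 : 0 < ν₂ := lt_min hν0 (by norm_num)
  have hν₂4 : ν₂ ≤ 1 / 4 := min_le_right _ _
  have hcard : ∀ (n : ℕ) (σ : Config n) (A : Finset (Config n)) (u : ℝ), (u = 1 ∨ u = -1) →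
      (∀ τ ∈ A, (1 - 2 * ν₂) * n ≤ u * innerSum σ τ) →
      (A.card : ℝ) ≤ Real.exp (min g a * n) := fun n σ A u hu hA =>
    hν n σ A u hu fun τ hτ => le_trans (by gcongr; exact min_le_left _ _) (hA τ hτ)
  have hr0 : 0 ≤ 1 - 2 * (ν₂ / 4) := by linarith
  have hr1 : 1 - 2 * (ν₂ / 4) < 1 := by linarith
  -- With `ν₁ = ν₂ / 4`, the base `1 - 2 ν₁` exceeds `1 - 2 ν₂`, so a single `k` serves both the gap
  -- and the second moment. The extra `6` in the threshold for `p` covers the powers set aside in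
  -- `exp_overlap_pow_le`.
  obtain ⟨k, hk⟩ := exists_pow_lt_of_lt_one
    (show 0 < min (g / (β - η) ^ 2) (1 / 8 / β ^ 2) by positivity) hr1
  rw [lt_min_iff, lt_div_iff₀ (by positivity), lt_div_iff₀ (by positivity)] at hk
  refine ⟨k + 6, ν₂ / 4, ν₂, a / (4 * Real.log 2), a / 2, by positivity, by linarith,
    by linarith, by positivity, by positivity, fun p hp => ?_⟩
  have hlim : ∀ m : ℝ, 0 < m →
      Tendsto (fun n : ℕ => Real.exp (-(n * η ^ 2 / m))) atTop (𝓝 0) := fun m hm => by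
    refine (tendsto_exp_neg_mul_natCast (a := η ^ 2 / m) (by positivity)).congr fun n => ?_
    congr 2
    ring
  refine ⟨fun n => 2 * Real.exp (-(n * η ^ 2 / 4)), ?_, ?_⟩
  · simpa using (hlim 4 (by norm_num)).const_mul 2
  refine tendsto_measure_one (fun n => disorder n p) _ (fun n => Real.exp (n * -g)
        + 4 * (momentExcess a n + 2 * Real.exp (-(n * η ^ 2 / 2)))
        + 2 * Real.exp (-(n * η ^ 2 / 4))) ?_ ?_
  · have h1 : Tendsto (fun n : ℕ => Real.exp (n * -g)) atTop (𝓝 0) :=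
      (tendsto_exp_neg_mul_natCast hg0).congr fun n => by congr 1; ring
    simpa using (h1.add (((tendsto_momentExcess ha0).add
      ((hlim 2 (by norm_num)).const_mul 2)).const_mul 4)).add
      ((hlim 4 (by norm_num)).const_mul 2)
  · have hD := (hlim 4 (by norm_num)).eventually_le_const (show (0 : ℝ) < 1 / 4 by norm_num)
    have hna := (tendsto_natCast_atTop_atTop.const_mul_atTop ha0).eventually_ge_atTop
      (4 * Real.log 2)
    filter_upwards [hD, hna, eventually_gt_atTop 0] with n hD hna hn
    refine measureReal_not_shattered_le hn hβ.le hκ.le hE0.le (by positivity) (by linarith)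
      (by linarith) ha0 (by omega) ?_ ?_ ?_ ?_ hD hna
    · calc β ^ 2 * (1 - 2 * ν₂) ^ (p - 6) ≤ β ^ 2 * (1 - 2 * (ν₂ / 4)) ^ (p - 6) := by
            gcongr <;> linarith
        _ ≤ β ^ 2 * (1 - 2 * (ν₂ / 4)) ^ k := by
            gcongr β ^ 2 * ?_
            exact pow_le_pow_of_le_one hr0 hr1.le (by omega)
        _ ≤ _ := by linarith
    · intro σ A u hu hA
      refine (hcard n σ A u hu hA).trans ?_
      gcongr
      refine (min_le_right _ _).trans (le_of_eq ?_)
      rw [← hη]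
      linarith
    · intro σ A hA
      refine (hcard n σ A 1 (.inl rfl) hA).trans ?_
      gcongr
      exact min_le_left _ _
    · have h1 : (1 - 2 * (ν₂ / 4)) ^ p ≤ (1 - 2 * (ν₂ / 4)) ^ k :=
        pow_le_pow_of_le_one hr0 hr1.le (by omega)
      have h2 : (β - η) ^ 2 * (1 - 2 * (ν₂ / 4)) ^ p ≤ g := by
        calc _ ≤ (β - η) ^ 2 * (1 - 2 * (ν₂ / 4)) ^ k := by gcongr
          _ ≤ _ := by linarith
      rw [← hη]
      linarith
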